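/- Let $q\ge 13$ be an odd prime power and $\eta\in\mathbb{F}_q$, $\eta\ne 0$. Let $k$ be an integer with $3\le k\le \frac{q-1}{2}-2$, let $n>k$, and let $\alpha_1,\dots,\alpha_n\in\mathbb{F}_q\cup\{\infty\}$ be distinct. Put $$\mathcal V=\Big\{\sum_{i=0}^{k-1}a_ix^i+\eta a_0x^{k} : a_0,\dots,a_{k-1}\in\mathbb{F}_q\Big\},$$ and let $f(\infty)$, for $f\in\mathcal V$, denote the coefficient of $x^{\ell}$ in $f$, where $\ell=\max\{\deg g: g\in\mathcal V\}$ (so $\ell=k$). Consider the twisted Reed–Solomon code with twist $t=1$ and hook $h=0$, $$\mathcal C=\{(f(\alpha_1),\dots,f(\alpha_n)) : f\in\mathcal V\}\subseteq\mathbb{F}_q^n .$$ If $\mathcal C$ is MDS, that is, if its minimum Hamming distance $d$ satisfies $d=n-\dim\mathcal C+1$, then $$n\le\frac{q+1}{2}.$$ -/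

import Mathlib

namespace TwistedRS

open Polynomial

noncomputable section

variable {F : Type*} [Field F]

/-- The minimum Hamming distance between two distinct codewords of the linear code `C ⊆ F ^ n`
(for the zero code, which has no such pair, the value is `0`). -/
def minDist [DecidableEq F] {n : ℕ} (C : Submodule F (Fin n → F)) : ℕ :=
  sInf {d : ℕ | ∃ c ∈ C, ∃ c' ∈ C, c ≠ c' ∧ hammingDist c c' = d}

/-- A linear code of length `n`, dimension `k` and minimum distance `d` is MDS if it attains the
Singleton bound, `d = n - k + 1`; it is written here as `k + d = n + 1` to avoid truncated
subtraction. -/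
def IsMDS [DecidableEq F] {n : ℕ} (C : Submodule F (Fin n → F)) : Prop :=
  Module.finrank F C + minDist C = n + 1

/-- The largest degree of a polynomial in `V` (meaningful when the degrees in `V` are bounded,
for instance when `V` is finite-dimensional). -/
def maxDegree (V : Submodule F F[X]) : ℕ :=
  sSup {d : ℕ | ∃ f ∈ V, f.natDegree = d}

/-- The value of a polynomial at a point of `F ∪ {∞}`, relative to `V`: the usual value at a point
of `F`, and at `∞` the coefficient of `X ^ ℓ`, where `ℓ` is the largest degree occurring in `V`. -/
def evalAt (V : Submodule F F[X]) : OnePoint F → F[X] →ₗ[F] F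
  | none => Polynomial.lcoeff F (maxDegree V)
  | some a => Polynomial.leval a

/-- The evaluation map `f ↦ [f(α₁), …, f(αₙ)]` of `α` on `V`. -/
def evalMap {n : ℕ} (V : Submodule F F[X]) (α : Fin n → OnePoint F) : V →ₗ[F] (Fin n → F) :=
  (LinearMap.pi fun i => evalAt V (α i)).comp V.subtype

/-- The space of `(k, t, h, η)`-twisted polynomials
`∑_{i < k} a_i X ^ i + η a_h X ^ (k - 1 + t)`, with hook `h < k` and twist `t`. Only the entries
`a_0, …, a_{k-1}` of the sequence `a` matter when `h < k`. -/
def twistedPolynomials (k t h : ℕ) (η : F) : Submodule F F[X] where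
  carrier := {f | ∃ a : ℕ → F,
    f = ∑ i ∈ Finset.range k, C (a i) * X ^ i + C (η * a h) * X ^ (k - 1 + t)}
  add_mem' := by
    rintro _ _ ⟨a, rfl⟩ ⟨b, rfl⟩
    refine ⟨a + b, ?_⟩
    simp only [Pi.add_apply, mul_add, map_add, add_mul, Finset.sum_add_distrib]
    ring
  zero_mem' := ⟨0, by simp⟩
  smul_mem' := by
    rintro c _ ⟨a, rfl⟩
    refine ⟨c • a, ?_⟩
    simp only [Polynomial.smul_eq_C_mul, mul_add, Finset.mul_sum, Pi.smul_apply, smul_eq_mul,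
      map_mul]
    congr 1
    · exact Finset.sum_congr rfl fun i _ => by ring
    · ring

/-- The twisted Reed–Solomon code with evaluation points `α`: the image of the space of
`(k, t, h, η)`-twisted polynomials under the evaluation map of `α`. -/
def twistedCode {n : ℕ} (α : Fin n → OnePoint F) (k t h : ℕ) (η : F) :
    Submodule F (Fin n → F) :=
  LinearMap.range (evalMap (twistedPolynomials k t h η) α)

end

end TwistedRS

/-!
Write `q = 2 m + 1` for the order of `F`. For an MDS code every nonzero codeword has fewer than `k`
zeros. Applied to monic polynomials with prescribed roots among the evaluation points, this says
that `0` and `∞` are not both evaluation points (`card_ne_of_isMDS`), and that no `k` nonzero finite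
evaluation points have product `(-1) ^ k / η` (`prod_ne_of_isMDS`). So if `n ≥ m + 2`, there are at
least `m + 1` evaluation points in the cyclic group `Fˣ` of order `2 m`, and a particular element
of `Fˣ` is not a product of `k` of them.

This contradicts `isSubsetSum_of_card_eq_succ`: in an (additively written) cyclic group of order
`2 m`, if `|A| = m + 1` and `3 ≤ k ≤ m - 2`, then every element is a sum of `k` distinct elements
of `A`. (The proof assumes `m ≥ 6` and `m ≠ 7`; a field of order `15` does not exist.) By
complements one may assume `k ≤ (m + 1) / 2`.

* For `k = 3` and `k = 4` the proof distinguishes the two cosets of the subgroup of index two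
  (`isSubsetSum_three`, `isSubsetSum_four`).
* For larger `k = i + 2 j` with `i = 3` or `i = 4`, one looks for `i` elements with sum `g - j h`
  together with `j` disjoint pairs with sum `h`. The `i` elements exist by the first case, so a
  failure means that they meet almost all pairs with sum `h`
  (`card_pairSupport_le_of_not_isSubsetSum`). This bounds the number of pairs for every `h` by
  little more than its average `(m + 1) / 4`, and for an `h` attaining the average it confines the
  `i`-element subsets with sum `g - j h`, up to at most one element each, to the union of the pairs
  with sum `h`. Then the number of pairs is far below average for too many other elements
  (`isSubsetSum_odd`, `isSubsetSum_even`).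
-/

namespace TwistedRS

open Finset

/-! ### Pairs with a given sum -/

section SubsetSums

lemma eq_sub_of_sub_eq {G : Type*} [AddCommGroup G] {a b c : G} (h : a - b = c) : b = a - c := by
  rw [← h, sub_sub_cancel]

variable {G : Type*} [AddCommGroup G] [DecidableEq G]

/-- `g` is the sum of `k` distinct elements of `A`. -/
def IsSubsetSum (A : Finset G) (k : ℕ) (g : G) : Prop :=
  ∃ S ⊆ A, S.card = k ∧ ∑ x ∈ S, x = g

/-- The set of all `x ∈ A` having a partner `h - x ∈ A` distinct from `x`: the union of the
two-element subsets of `A` with sum `h`. Its cardinality is twice their number. -/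
def pairSupport (A : Finset G) (h : G) : Finset G :=
  A.filter fun x => h - x ∈ A ∧ h - x ≠ x

lemma mem_pairSupport {A : Finset G} {h x : G} :
    x ∈ pairSupport A h ↔ x ∈ A ∧ h - x ∈ A ∧ h - x ≠ x := by
  simp [pairSupport]

lemma pairSupport_subset (A : Finset G) (h : G) : pairSupport A h ⊆ A :=
  filter_subset _ _

lemma sub_mem_pairSupport {A : Finset G} {h x : G} (hx : x ∈ pairSupport A h) :
    h - x ∈ pairSupport A h := by
  rw [mem_pairSupport] at *
  rw [sub_sub_cancel]
  exact ⟨hx.2.1, hx.1, hx.2.2.symm⟩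

/-- Double counting of the ordered pairs of distinct elements of `A` with sum in `T`. -/
lemma sum_card_pairSupport_on (A T : Finset G) :
    ∑ h ∈ T, (pairSupport A h).card
      = ∑ x ∈ A, ((A.erase x).filter fun y => x + y ∈ T).card := by
  have h1 := sum_card_bipartiteAbove_eq_sum_card_bipartiteBelow
    (fun (h x : G) => h - x ∈ A ∧ h - x ≠ x) (s := T) (t := A)
  refine h1.trans (sum_congr rfl fun x _ => ?_)
  refine card_bij' (fun h _ => h - x) (fun y _ => x + y) ?_ ?_ ?_ ?_
  · intro h hh
    simp only [bipartiteBelow, mem_filter, mem_erase] at hh ⊢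
    exact ⟨⟨hh.2.2, hh.2.1⟩, by simpa using hh.1⟩
  · intro y hy
    simp only [bipartiteBelow, mem_filter, mem_erase] at hy ⊢
    simpa using ⟨hy.2, hy.1.2, hy.1.1⟩
  · intro h _
    abel
  · intro y _
    abel

/-- A set closed under the fixed-point-free map `x ↦ h - x` is a disjoint union of pairs with
sum `h`, so `j` such pairs can be chosen in it as soon as it has at least `2 j - 1` elements. -/
lemma exists_subset_sum_eq_nsmul (h : G) (j : ℕ) (W : Finset G)
    (hW : ∀ x ∈ W, h - x ∈ W ∧ h - x ≠ x) (hj : 2 * j ≤ W.card + 1) :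
    ∃ J ⊆ W, J.card = 2 * j ∧ ∑ x ∈ J, x = j • h := by
  induction j generalizing W with
  | zero => exact ⟨∅, by simp⟩
  | succ j ih =>
    obtain ⟨x, hx⟩ : W.Nonempty := card_pos.1 (by omega)
    obtain ⟨hx', hne⟩ := hW x hx
    have hc : ((W.erase x).erase (h - x)).card = W.card - 1 - 1 := by
      rw [card_erase_of_mem (mem_erase.2 ⟨hne, hx'⟩), card_erase_of_mem hx]
    obtain ⟨J, hJ, hJc, hJs⟩ := ih ((W.erase x).erase (h - x)) (by
      intro y hy
      simp only [mem_erase] at hy ⊢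
      refine ⟨⟨fun e => hy.2.1 (sub_right_injective e), fun e => hy.1 ?_, (hW y hy.2.2).1⟩,
        (hW y hy.2.2).2⟩
      rw [← e]; abel) (by omega)
    have h1 : h - x ∉ J := fun hm => by simpa using hJ hm
    have h2 : x ∉ insert (h - x) J := by
      rw [mem_insert, not_or]
      exact ⟨hne.symm, fun hm => by simpa using hJ hm⟩
    refine ⟨insert x (insert (h - x) J), ?_, ?_, ?_⟩
    · exact insert_subset hx (insert_subset hx'
        (hJ.trans ((erase_subset _ _).trans (erase_subset _ _))))
    · rw [card_insert_of_notMem h2, card_insert_of_notMem h1, hJc]; ring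
    · rw [sum_insert h2, sum_insert h1, hJs, succ_nsmul]; abel

/-- Exchange principle. If `g` is not a sum of `i + 2 j` elements of `A`, then an `i`-subset `C`
with sum `g - j h` cannot be completed by `j` pairs with sum `h`; so `C` meets nearly all pairs
with sum `h`, and their number is bounded in terms of `|C ∩ pairSupport A h|`. -/
lemma card_pairSupport_le_of_not_isSubsetSum {A C : Finset G} {g h : G} {i j : ℕ}
    (hg : ¬ IsSubsetSum A (i + 2 * j) g) (hC : C ⊆ A) (hCi : C.card = i)
    (hCs : ∑ x ∈ C, x = g - j • h) :
    (pairSupport A h).card + 2 ≤ 2 * j + 2 * (C ∩ pairSupport A h).card := by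
  by_contra! hlt
  set V := pairSupport A h with hV
  set D := C ∩ V with hD
  set W := V \ (D ∪ D.image fun x => h - x) with hWdef
  have hWcard : V.card ≤ W.card + 2 * D.card := by
    have h1 := le_card_sdiff (D ∪ D.image fun x => h - x) V
    have h2 := card_union_le D (D.image fun x => h - x)
    have h3 : (D.image fun x => h - x).card ≤ D.card := card_image_le
    rw [← hWdef] at h1
    omega
  have hWC : ∀ x ∈ W, x ∉ C := by
    intro x hx hxC
    rw [hWdef, mem_sdiff, mem_union, not_or] at hx
    exact hx.2.1 (mem_inter.2 ⟨hxC, hx.1⟩)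
  obtain ⟨J, hJ, hJc, hJs⟩ := exists_subset_sum_eq_nsmul h j W (by
    intro x hx
    rw [hWdef, mem_sdiff, mem_union, not_or, mem_image] at hx ⊢
    refine ⟨⟨sub_mem_pairSupport hx.1, fun hm => hx.2.2 ⟨_, hm, by abel⟩, ?_⟩,
      (mem_pairSupport.1 hx.1).2.2⟩
    rintro ⟨y, hy, e⟩
    exact hx.2.1 (sub_right_injective e ▸ hy)) (by omega)
  have hdis : Disjoint C J := disjoint_left.2 fun x hx hxJ => hWC x (hJ hxJ) hx
  refine hg ⟨C ∪ J, union_subset hC ?_, ?_, ?_⟩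
  · exact hJ.trans (sdiff_subset.trans (pairSupport_subset A h))
  · rw [card_union_of_disjoint hdis, hCi, hJc]
  · rw [sum_union hdis, hCs, hJs]; abel

/-- If `A` is a subset of a set `F` that is stable under `x ↦ h - x`, then at least
`2 |A| - |F|` elements `x` of `A` satisfy `h - x ∈ A`. -/
lemma two_mul_card_le_card_filter_sub_mem (A F : Finset G) (h : G) (hA : A ⊆ F)
    (hF : ∀ x ∈ F, h - x ∈ F) :
    2 * A.card ≤ F.card + (A.filter fun x => h - x ∈ A).card := by
  have h1 : ((A.filter fun x => h - x ∉ A).image fun x => h - x) ⊆ F \ A := by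
    intro y hy
    obtain ⟨x, hx, rfl⟩ := mem_image.1 hy
    rw [mem_filter] at hx
    exact mem_sdiff.2 ⟨hF x (hA hx.1), hx.2⟩
  have h2 := card_le_card h1
  rw [card_image_of_injective _ sub_right_injective, card_sdiff_of_subset hA] at h2
  have h3 := card_filter_add_card_filter_not (s := A) (fun x => h - x ∈ A)
  have h4 := card_le_card hA
  omega

variable [Fintype G]

lemma sum_card_pairSupport (A : Finset G) :
    ∑ h, (pairSupport A h).card = A.card * (A.card - 1) := by
  rw [sum_card_pairSupport_on, sum_const_nat (m := A.card - 1)]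
  intro x hx
  simp [card_erase_of_mem hx]

lemma card_filter_nsmul_eq_le [IsAddCyclic G] {n : ℕ} (hn : 0 < n) (A : Finset G) (u : G) :
    (A.filter fun x => n • x = u).card ≤ n := by
  obtain h0 | ⟨x₀, hx₀⟩ := (A.filter fun x => n • x = u).eq_empty_or_nonempty
  · simp [h0]
  · refine le_trans (card_le_card_of_injOn (fun x => x - x₀) ?_ ?_)
      (IsAddCyclic.card_nsmul_eq_zero_le (α := G) hn)
    · intro x hx
      have hx : x ∈ A ∧ n • x = u := by simpa using hx
      have hx₀ : x₀ ∈ A ∧ n • x₀ = u := by simpa using hx₀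
      simp [smul_sub, hx.2, hx₀.2]
    · exact fun x _ y _ e => sub_left_injective e

/-- Elements of `A` with partner `h - x` in `A`, the partner being allowed to coincide with the
element. -/
lemma card_filter_sub_mem_le [IsAddCyclic G] (A : Finset G) (h : G) :
    (A.filter fun x => h - x ∈ A).card ≤ (pairSupport A h).card + 2 := by
  have h1 : (A.filter fun x => h - x ∈ A) ⊆ pairSupport A h ∪ A.filter fun x => 2 • x = h := by
    intro x hx
    rw [mem_filter] at hx
    rw [mem_union, mem_pairSupport, mem_filter, two_nsmul]
    by_cases e : h - x = x
    · exact Or.inr ⟨hx.1, (sub_eq_iff_eq_add.1 e).symm⟩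
    · exact Or.inl ⟨hx.1, hx.2, e⟩
  have h2 := card_filter_nsmul_eq_le two_pos A h
  exact (card_le_card h1).trans ((card_union_le _ _).trans (by omega))

end SubsetSums

/-! ### Sums of three and of four elements -/

section SubsetSums

/-- A cyclic group of even order has a surjective homomorphism onto `ℤ / 2`. -/
lemma exists_parity {G : Type*} [AddCommGroup G] [Fintype G] [IsAddCyclic G]
    (h : 2 ∣ Fintype.card G) :
    ∃ ε : G →+ ZMod 2, Function.Surjective ε := by
  rw [← Nat.card_eq_fintype_card] at h
  let e := zmodAddCyclicAddEquiv (G := G) inferInstance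
  exact ⟨(ZMod.castHom h (ZMod 2)).toAddMonoidHom.comp e.symm.toAddMonoidHom,
    (ZMod.castHom_surjective h).comp e.symm.surjective⟩

lemma card_fiber_parity {G : Type*} [AddCommGroup G] [Fintype G] {m : ℕ}
    (hG : Fintype.card G = 2 * m) (ε : G →+ ZMod 2)
    (hε : Function.Surjective ε) (e : ZMod 2) :
    (univ.filter fun x => ε x = e).card = m := by
  have h0 : ∀ e e' : ZMod 2, (univ.filter fun x => ε x = e).card
      = (univ.filter fun x => ε x = e').card :=
    fun e e' => AddMonoidHom.card_fiber_eq_of_mem_range ε (hε e) (hε e')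
  have h1 := card_eq_sum_card_fiberwise (f := ε) (s := univ) (t := univ) (fun _ _ => by simp)
  rw [sum_congr rfl fun e' _ => h0 e' e, sum_const, card_univ, card_univ, ZMod.card, hG,
    smul_eq_mul] at h1
  omega

lemma card_filter_add_card_filter_parity {G : Type*} [AddCommGroup G] (A : Finset G)
    (ε : G →+ ZMod 2) (e : ZMod 2) :
    (A.filter fun x => ε x = e).card + (A.filter fun x => ε x = e + 1).card = A.card := by
  rw [← card_filter_add_card_filter_not (s := A) (fun x => ε x = e)]
  congr 2
  ext x
  simp only [mem_filter]
  have : ∀ a b : ZMod 2, a = b + 1 ↔ ¬ a = b := by decide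
  rw [this]

variable {G : Type*} [AddCommGroup G] [DecidableEq G] [Fintype G]

/-- Three-element sums. Write `A = X ∪ Y`, where `X` consists of the elements of the parity of `g`.
If `g` is missed, then `y₀ + (Y \ {y₀})` is the same set for every `y₀ ∈ Y`; comparing the sums of
its elements, `|Y| - 2` kills all differences of elements of `Y`, so `|Y| ≤ 2`. Hence `X` is nearly
a full parity class, and `g` is a sum of three elements of `X`. -/
theorem isSubsetSum_three [IsAddCyclic G] {m : ℕ} (hG : Fintype.card G = 2 * m) (hm : 6 ≤ m)
    {A : Finset G} (hA : A.card = m + 1) (g : G) : IsSubsetSum A 3 g := by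
  by_contra hg
  obtain ⟨ε, hε⟩ := exists_parity (G := G) ⟨m, hG⟩
  have key : ∀ x ∈ A, ∀ y ∈ A, g - x - y ∈ A → x ≠ y → g - x - y ≠ x → g - x - y ≠ y → False := by
    intro x hx y hy hz h1 h2 h3
    refine hg ⟨{x, y, g - x - y}, ?_, card_eq_three.2 ⟨x, y, _, h1, h2.symm, h3.symm, rfl⟩, ?_⟩
    · simp [insert_subset_iff, hx, hy, hz]
    · rw [sum_insert (by simp [h1, h2.symm]), sum_insert (by simpa using h3.symm), sum_singleton]
      abel
  set F := univ.filter fun x => ε x = ε g with hF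
  set X := A.filter fun x => ε x = ε g with hX
  set Y := A.filter fun x => ε x = ε g + 1 with hY
  have hFc : F.card = m := card_fiber_parity hG ε hε _
  have hXF : X ⊆ F := filter_subset_filter _ (subset_univ _)
  have hXY : X.card + Y.card = m + 1 := hA ▸ card_filter_add_card_filter_parity A ε (ε g)
  have hXm : X.card ≤ m := hFc ▸ card_le_card hXF
  have hsub : ∀ a b c : ZMod 2, (b = a ∧ c = a) ∨ (b = a + 1 ∧ c = a + 1) → a - b - c = a := by
    decide
  have hne : ∀ a : ZMod 2, a + 1 ≠ a := by decide
  -- Both sides of `himage` have `|Y| - 1` elements because `|X| + |Y| = m + 1`.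
  have hY2 : Y.card ≤ 2 := by
    by_contra! hY3
    have himage : ∀ y₀ ∈ Y, ((Y.erase y₀).image fun y => g - y₀ - y) = F \ X := by
      intro y₀ hy₀
      refine eq_of_subset_of_card_le ?_ ?_
      · intro z hz
        obtain ⟨y, hy, rfl⟩ := mem_image.1 hz
        rw [mem_erase] at hy
        obtain ⟨hyne, hy⟩ := hy
        rw [hY, mem_filter] at hy hy₀
        have hz : ε (g - y₀ - y) = ε g := by
          rw [map_sub, map_sub]
          exact hsub _ _ _ (Or.inr ⟨hy₀.2, hy.2⟩)
        refine mem_sdiff.2 ⟨by simpa [hF] using hz, fun hzX => ?_⟩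
        refine key y₀ hy₀.1 y hy.1 (mem_filter.1 hzX).1 hyne.symm (fun e => ?_) (fun e => ?_)
        · rw [e, hy₀.2] at hz; exact hne _ hz
        · rw [e, hy.2] at hz; exact hne _ hz
      · rw [card_image_of_injective _ sub_right_injective, card_erase_of_mem hy₀,
          card_sdiff_of_subset hXF]
        omega
    have hsum : ∀ y₀ ∈ Y, (Y.card - 2) • y₀
        = (Y.card - 1) • g - ∑ y ∈ Y, y - ∑ z ∈ F \ X, z := by
      intro y₀ hy₀
      rw [← himage y₀ hy₀, sum_image fun _ _ _ _ e => sub_right_injective e, sum_sub_distrib,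
        sum_const, card_erase_of_mem hy₀, ← add_sum_erase _ _ hy₀]
      have : Y.card - 1 = (Y.card - 2) + 1 := by omega
      rw [this, smul_sub, succ_nsmul y₀]
      abel
    obtain ⟨y₁, hy₁⟩ : Y.Nonempty := card_pos.1 (by omega)
    have h1 := card_filter_nsmul_eq_le (n := Y.card - 2) (by omega) Y ((Y.card - 2) • y₁)
    rw [filter_true_of_mem fun y hy => (hsum y hy).trans (hsum y₁ hy₁).symm] at h1
    omega
  -- Some `c ∈ X` has at most one `a ∈ X` with `2 a + c = g`, by averaging.
  obtain ⟨c, hc, hc1⟩ : ∃ c ∈ X, (X.filter fun a => g - a - a = c).card ≤ 1 := by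
    by_contra! hcon
    have h1 : 2 * X.card ≤ ∑ c ∈ X, (X.filter fun a => g - a - a = c).card := by
      rw [mul_comm, ← smul_eq_mul]
      exact card_nsmul_le_sum _ _ _ fun c hc => hcon c hc
    have h2 : ∑ c ∈ X, (X.filter fun a => g - a - a = c).card ≤ X.card := by
      simp_rw [card_filter]
      rw [sum_comm]
      calc _ ≤ ∑ a ∈ X, 1 := sum_le_sum fun a _ => by rw [sum_ite_eq]; split_ifs <;> simp
        _ = X.card := by simp
    omega
  have h1 := two_mul_card_le_card_filter_sub_mem (X.erase c) F (g - c)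
    ((erase_subset _ _).trans hXF) (by
      intro x hx
      have hx : ε x = ε g := by simpa [hF] using hx
      have : ε (g - c - x) = ε g := by
        rw [map_sub, map_sub]
        exact hsub _ _ _ (Or.inl ⟨(mem_filter.1 hc).2, hx⟩)
      simpa [hF] using this)
  have h2 : ((X.erase c).filter fun x => g - c - x ∈ X.erase c)
      ⊆ X.filter fun a => g - a - a = c := by
    intro x hx
    simp only [mem_filter, mem_erase] at hx ⊢
    refine ⟨hx.1.2, by_contra fun hxc => ?_⟩
    refine key c (mem_filter.1 hc).1 x (mem_filter.1 hx.1.2).1 (mem_filter.1 hx.2.2).1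
      hx.1.1.symm hx.2.1 fun e => hxc ?_
    rw [sub_sub, sub_eq_iff_eq_add] at e
    rw [e]; abel
  have h3 := card_le_card h2
  rw [card_erase_of_mem hc] at h1
  omega

/-- Four-element sums. If `g` is missed, then at most two pairs have sum `h` unless no pair has sum
`g - h`. The latter only occurs for `g - h` of parity `0`, and then the two parity classes of `A`
have nearly the same size. So there are too few pairs with sum `h` in the parity class where
`g - h` has parity `1`. -/
theorem isSubsetSum_four [IsAddCyclic G] {m : ℕ} (hG : Fintype.card G = 2 * m) (hm : 8 ≤ m)
    {A : Finset G} (hA : A.card = m + 1) (g : G) : IsSubsetSum A 4 g := by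
  by_contra hg
  obtain ⟨ε, hε⟩ := exists_parity (G := G) ⟨m, hG⟩
  have hsmall : ∀ h, (pairSupport A (g - h)).Nonempty → (pairSupport A h).card ≤ 4 := by
    rintro h ⟨x, hx⟩
    rw [mem_pairSupport] at hx
    have h1 := card_pairSupport_le_of_not_isSubsetSum (A := A) (C := {x, g - h - x}) (g := g)
      (h := h) (i := 2) (j := 1) hg (by simp [insert_subset_iff, hx.1, hx.2.1])
      (card_pair hx.2.2.symm) (by rw [sum_pair hx.2.2.symm]; simp)
    have h2 : (({x, g - h - x} : Finset G) ∩ pairSupport A h).card ≤ 2 :=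
      (card_le_card inter_subset_left).trans card_le_two
    omega
  -- When no pair has sum `t`, only `x` with `2 x = t` can have its partner `t - x` in `A`.
  have hdiag : ∀ t, pairSupport A t = ∅ → ∀ x ∈ A, t - x ∈ A → t = x + x := by
    intro t ht x hx hx'
    by_contra hne
    have : x ∈ pairSupport A t := mem_pairSupport.2 ⟨hx, hx', fun e => hne (sub_eq_iff_eq_add.1 e)⟩
    simp [ht] at this
  -- As `|A| > m`, the sets `A` and `t - A` intersect.
  have hpartner : ∀ t, (A.filter fun x => t - x ∈ A).Nonempty := by
    intro t
    have h1 := two_mul_card_le_card_filter_sub_mem A univ t (subset_univ _) (by simp)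
    rw [card_univ, hG, hA] at h1
    exact card_pos.1 (by omega)
  have hpar : ∀ t, pairSupport A t = ∅ → ε t = 0 := by
    intro t ht
    obtain ⟨x, hx⟩ := hpartner t
    rw [mem_filter] at hx
    rw [hdiag t ht x hx.1 hx.2, map_add]
    exact CharTwo.add_self_eq_zero _
  have htot := sum_card_pairSupport A
  rw [hA, Nat.add_sub_cancel] at htot
  obtain ⟨t, ht⟩ : ∃ t, pairSupport A t = ∅ := by
    by_contra! hcon
    have h1 := sum_le_card_nsmul univ (fun h => (pairSupport A h).card) 4
      fun h _ => hsmall h (hcon _)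
    rw [htot, card_univ, hG, smul_eq_mul] at h1
    nlinarith
  have hεt := hpar t ht
  set a := (A.filter fun x => ε x = 0).card with ha
  set b := (A.filter fun x => ε x = 1).card with hb
  have hab : a + b = m + 1 := by
    have := card_filter_add_card_filter_parity A ε 0
    rwa [hA, zero_add] at this
  -- At most two elements of `A` have their partner in `A`, so no parity class is much overfull.
  have hbal : ∀ e, 2 * (A.filter fun x => ε x = e).card ≤ m + 2 := by
    intro e
    have h1 := two_mul_card_le_card_filter_sub_mem (A.filter fun x => ε x = e)
      (univ.filter fun x => ε x = e) t (filter_subset_filter _ (subset_univ _)) (by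
        intro x hx
        have hx : ε x = e := by simpa using hx
        have : ∀ e : ZMod 2, 0 - e = e := by decide
        simp [hεt, hx])
    rw [card_fiber_parity hG ε hε] at h1
    have h2 : ((A.filter fun x => ε x = e).filter fun x => t - x ∈ A.filter fun x => ε x = e)
        ⊆ A.filter fun x => 2 • x = t := by
      intro x hx
      simp only [mem_filter] at hx ⊢
      exact ⟨hx.1.1, by rw [two_nsmul, ← hdiag t ht x hx.1.1 hx.2.1]⟩
    have h3 := (card_le_card h2).trans (card_filter_nsmul_eq_le two_pos A t)
    omega
  have ha2 := hbal 0
  have hb2 := hbal 1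
  rw [← ha] at ha2
  rw [← hb] at hb2
  have hsq : m * m + 2 * m ≤ 4 * (a * b) := by
    have h1 : ((a : ℤ) - b) ^ 2 ≤ 1 := by
      rw [sq_le_one_iff_abs_le_one, abs_le]
      omega
    have h2 : (m : ℤ) = a + b - 1 := by omega
    zify
    rw [h2]
    linarith
  have hsum : ∀ e, ∑ h ∈ univ.filter (fun h => ε h = e), (pairSupport A h).card
      = ∑ x ∈ A, ((A.erase x).filter fun y => ε x + ε y = e).card := by
    intro e
    rw [sum_card_pairSupport_on]
    simp
  have hcount : ∀ e x, (A.erase x).filter (fun y => ε x + ε y = e)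
      = (A.filter fun y => ε y = e - ε x).erase x := by
    intro e x
    ext y
    simp only [mem_filter, mem_erase, eq_sub_iff_add_eq']
    tauto
  have hsplit : ∀ f : G → ℕ, ∑ x ∈ A, f x
      = ∑ x ∈ A.filter (fun x => ε x = 0), f x + ∑ x ∈ A.filter (fun x => ε x = 1), f x := by
    intro f
    rw [← sum_filter_add_sum_filter_not A (fun x => ε x = 0)]
    congr 2
    ext x
    have : ∀ u : ZMod 2, ¬ u = 0 ↔ u = 1 := by decide
    simp [this]
  have hfew : ∀ h, ε h = ε g + 1 → (pairSupport A h).card ≤ 4 := by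
    intro h hh
    refine hsmall h (nonempty_iff_ne_empty.2 fun h0 => ?_)
    have h1 := hpar _ h0
    rw [map_sub, hh] at h1
    have : ∀ u : ZMod 2, u - (u + 1) ≠ 0 := by decide
    exact this _ h1
  obtain hg0 | hg1 : ε g + 1 = 1 ∨ ε g + 1 = 0 := by
    have : ∀ u : ZMod 2, u + 1 = 1 ∨ u + 1 = 0 := by decide
    exact this _
  · have h1 : ∑ h ∈ univ.filter (fun h => ε h = 1), (pairSupport A h).card = 2 * (a * b) := by
      rw [hsum, hsplit, sum_const_nat (m := b), sum_const_nat (m := a), ← ha, ← hb]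
      · ring
      · intro x hx
        rw [hcount, (mem_filter.1 hx).2, erase_eq_of_notMem, sub_self, ha]
        simp [(mem_filter.1 hx).2]
      · intro x hx
        rw [hcount, (mem_filter.1 hx).2, erase_eq_of_notMem, sub_zero, hb]
        simp [(mem_filter.1 hx).2]
    have h2 := sum_le_card_nsmul (univ.filter fun h => ε h = 1)
      (fun h => (pairSupport A h).card) 4 fun h hh => hfew h (by simpa [hg0] using hh)
    rw [h1, card_fiber_parity hG ε hε, smul_eq_mul] at h2
    nlinarith
  · have h1 : ∑ h ∈ univ.filter (fun h => ε h = 0), (pairSupport A h).card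
        = a * (a - 1) + b * (b - 1) := by
      rw [hsum, hsplit, sum_const_nat (m := a - 1), sum_const_nat (m := b - 1), ← ha, ← hb]
      · intro x hx
        rw [hcount, card_erase_of_mem] <;> simp_all
      · intro x hx
        rw [hcount, card_erase_of_mem] <;> simp_all
    have htm : t ∈ univ.filter fun h => ε h = 0 := by simpa using hεt
    have h2 := sum_le_card_nsmul ((univ.filter fun h => ε h = 0).erase t)
      (fun h => (pairSupport A h).card) 4 fun h hh => hfew h (by
        rw [hg1]; simpa using (mem_erase.1 hh).2)
    rw [card_erase_of_mem htm, card_fiber_parity hG ε hε, smul_eq_mul] at h2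
    rw [← add_sum_erase _ _ htm, ht, card_empty, zero_add] at h1
    rw [h1] at h2
    have h3 : a * (a - 1) + b * (b - 1) + (a + b) = a * a + b * b := by
      rcases a with _ | a <;> rcases b with _ | b <;> simp <;> ring
    have h4 : (m - 1) * 4 = 4 * m - 4 := by omega
    have h5 : (m + 1) * (m + 1) = a * a + b * b + 2 * (a * b) := by rw [← hab]; ring
    have h6 : 2 * (a * b) ≤ a * a + b * b := by nlinarith [sq_nonneg ((a : ℤ) - b)]
    have h7 : 8 * m ≤ m * m := Nat.mul_le_mul_right m hm
    have h8 : (m + 1) * (m + 1) = m * m + 2 * m + 1 := by ring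
    omega

end SubsetSums

/-! ### Sums of `k` elements -/

section SubsetSums

variable {G : Type*} [AddCommGroup G] [DecidableEq G] [Fintype G]

/-- Sums of an odd number `k = 2 j + 3 ≥ 5` of elements, from three elements and `j` pairs with a
common sum `h`. If `g` is missed, no `h` is the sum of more than `(k + 1) / 2` pairs, which is close
to the average. For `h` attaining this bound, all three-element subsets with sum `g - j h` lie in
`pairSupport A h`, so that many elements are the sum of at most one pair; this contradicts the
average unless `k = 5` and `m = 9`, where the set of these exceptional elements is determined. -/
theorem isSubsetSum_odd [IsAddCyclic G] {m j : ℕ} (hG : Fintype.card G = 2 * m) (hj : 1 ≤ j)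
    (hjm : 2 * (3 + 2 * j) ≤ m + 1) {A : Finset G} (hA : A.card = m + 1) (g : G) :
    IsSubsetSum A (3 + 2 * j) g := by
  by_contra hg
  have hmax : ∀ h, (pairSupport A h).card ≤ 2 * j + 4 := by
    intro h
    obtain ⟨C, hC, hC3, hCs⟩ := isSubsetSum_three hG (by omega) hA (g - j • h)
    have h1 := card_pairSupport_le_of_not_isSubsetSum hg hC hC3 hCs
    have h2 : (C ∩ pairSupport A h).card ≤ 3 := hC3 ▸ card_le_card inter_subset_left
    omega
  have htot := sum_card_pairSupport A
  rw [hA, Nat.add_sub_cancel] at htot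
  -- The elements that are the sum of at most one pair.
  set L := univ.filter fun l => (pairSupport A l).card ≤ 2 with hL
  have himage : ∀ h, 2 * j + 3 ≤ (pairSupport A h).card →
      ((A \ pairSupport A h).image fun c => g - j • h - c) ⊆ L := by
    intro h hh l hl
    obtain ⟨c, hc, rfl⟩ := mem_image.1 hl
    rw [mem_sdiff] at hc
    rw [hL, mem_filter]
    refine ⟨mem_univ _, ?_⟩
    have h1 : pairSupport A (g - j • h - c) ⊆ {c, g - j • h - c - c} := by
      intro x hx
      rw [mem_pairSupport] at hx
      by_contra hxc
      simp only [mem_insert, mem_singleton, not_or] at hxc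
      have hxc' : g - j • h - c - x ≠ c := fun e => hxc.2 (eq_sub_of_sub_eq e)
      have h2 := card_pairSupport_le_of_not_isSubsetSum (C := {c, x, g - j • h - c - x}) (h := h) hg
        (by simp [insert_subset_iff, hx.1, hx.2.1, hc.1])
        (card_eq_three.2 ⟨c, x, _, Ne.symm hxc.1, hxc'.symm, hx.2.2.symm, rfl⟩)
        (by
          rw [sum_insert (by simp [Ne.symm hxc.1, hxc'.symm]), sum_pair hx.2.2.symm]
          abel)
      have h3 : ({c, x, g - j • h - c - x} : Finset G) ∩ pairSupport A h
          ⊆ {x, g - j • h - c - x} := by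
        intro y hy
        rw [mem_inter, mem_insert] at hy
        obtain ⟨rfl | hy, hy'⟩ := hy
        · exact absurd hy' hc.2
        · exact hy
      have h4 := (card_le_card h3).trans card_le_two
      omega
    exact (card_le_card h1).trans card_le_two
  have himage_card : ∀ h, ((A \ pairSupport A h).image fun c => g - j • h - c).card
      = m + 1 - (pairSupport A h).card := by
    intro h
    rw [card_image_of_injective _ sub_right_injective,
      card_sdiff_of_subset (pairSupport_subset A h), hA]
  obtain ⟨h₀, hh₀⟩ : ∃ h, 2 * j + 3 ≤ (pairSupport A h).card := by
    by_contra! hcon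
    have h1 := sum_le_card_nsmul univ (fun h => (pairSupport A h).card) (2 * j + 2)
      fun h _ => Nat.le_of_lt_succ (hcon h)
    rw [htot, card_univ, hG, smul_eq_mul] at h1
    nlinarith
  have hLcard : m + 1 ≤ L.card + (2 * j + 4) := by
    have h1 := card_le_card (himage h₀ hh₀)
    have h2 := hmax h₀
    rw [himage_card] at h1
    omega
  have hLnot := card_filter_add_card_filter_not (s := univ) fun l => (pairSupport A l).card ≤ 2
  rw [← hL, card_univ, hG] at hLnot
  have hbound : (m + 1) * m ≤ 2 * L.card + (2 * j + 4) * (2 * m - L.card) := by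
    rw [← htot, ← sum_filter_add_sum_filter_not univ fun l => (pairSupport A l).card ≤ 2]
    refine add_le_add ?_ ?_
    · rw [mul_comm]
      exact sum_le_card_nsmul L _ _ fun l hl => (mem_filter.1 hl).2
    · rw [show 2 * m - L.card = (univ.filter fun l => ¬ (pairSupport A l).card ≤ 2).card by omega,
        mul_comm]
      exact sum_le_card_nsmul _ _ _ fun l _ => hmax l
  -- The slacks `u`, `v` turn `hbound` into a polynomial inequality in nonnegative variables.
  obtain ⟨rfl, rfl⟩ : j = 1 ∧ m = 9 := by
    obtain ⟨u, rfl⟩ : ∃ u, m = 4 * j + 5 + u := ⟨m - (4 * j + 5), by omega⟩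
    obtain ⟨v, hv⟩ : ∃ v, L.card = 2 * j + 2 + u + v := ⟨L.card - (2 * j + 2 + u), by omega⟩
    obtain ⟨i, rfl⟩ : ∃ i, j = i + 1 := ⟨j - 1, by omega⟩
    obtain ⟨w, hw⟩ : ∃ w, 2 * (4 * (i + 1) + 5 + u) = L.card + w := ⟨_, hLnot.symm⟩
    rw [hw, Nat.add_sub_cancel_left] at hbound
    obtain rfl : w = 6 * (i + 1) + 8 + u - v := by omega
    have hw' : v ≤ 6 * (i + 1) + 8 + u := by omega
    zify [hw'] at hbound hv
    rw [hv] at hbound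
    have hi : (0 : ℤ) ≤ i := by positivity
    have hu : (0 : ℤ) ≤ u := by positivity
    have hv0 : (0 : ℤ) ≤ v := by positivity
    have h0 : (i : ℤ) = 0 ∧ (u : ℤ) = 0 := by
      constructor
      · by_contra hne
        have : (1 : ℤ) ≤ i := by omega
        nlinarith [mul_nonneg hi hu, mul_nonneg hi hv0, mul_nonneg hu hu]
      · by_contra hne
        have : (1 : ℤ) ≤ u := by omega
        nlinarith [mul_nonneg hi hu, mul_nonneg hi hv0, mul_nonneg hu hu]
    omega
  have hL4 : L.card = 4 := by omega
  -- For `h ∈ D`, the image in `himage h` is all of `L`; and `D` is large, since the total number of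
  -- ordered pairs is only 18 below its upper bound.
  set B := univ.filter fun h => (pairSupport A h).card ≤ 4 with hB
  set D := univ.filter fun h => ¬ (pairSupport A h).card ≤ 4 with hD
  have hBD : B.card + D.card = 18 := by
    have := card_filter_add_card_filter_not (s := univ) fun h => (pairSupport A h).card ≤ 4
    rwa [card_univ, hG] at this
  have hLB : L ⊆ B := by
    intro l hl
    rw [hL, mem_filter] at hl
    rw [hB, mem_filter]
    exact ⟨hl.1, by omega⟩
  have hD13 : 13 ≤ D.card := by
    have h1 : ∑ h ∈ D, (pairSupport A h).card ≤ D.card * 6 :=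
      sum_le_card_nsmul _ _ _ fun h _ => hmax h
    have h2 : ∑ h ∈ L, (pairSupport A h).card ≤ L.card * 2 :=
      sum_le_card_nsmul _ _ _ fun h hh => (mem_filter.1 hh).2
    have h3 : ∑ h ∈ B \ L, (pairSupport A h).card ≤ (B \ L).card * 4 :=
      sum_le_card_nsmul _ _ _ fun h hh => (mem_filter.1 (mem_sdiff.1 hh).1).2
    have h4 := sum_sdiff hLB (f := fun h => (pairSupport A h).card)
    have h5 := sum_filter_add_sum_filter_not univ (fun h => (pairSupport A h).card ≤ 4)
      (fun h => (pairSupport A h).card)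
    have h6 := card_sdiff_add_card_eq_card hLB
    rw [htot, ← hB, ← hD] at h5
    omega
  obtain ⟨l, hl⟩ : L.Nonempty := card_pos.1 (by omega)
  -- `h ↦ g - l - h` embeds the at least 13 elements of `D` into the 10 elements of `A`.
  have hDA : (D.image fun h => g - l - h) ⊆ A := by
    intro z hz
    obtain ⟨h, hh, rfl⟩ := mem_image.1 hz
    rw [hD, mem_filter] at hh
    have h1 := eq_of_subset_of_card_le (himage h (by omega)) (by
      have := hmax h
      rw [himage_card, hL4]
      omega)
    rw [← h1] at hl
    obtain ⟨c, hc, rfl⟩ := mem_image.1 hl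
    have : g - (g - 1 • h - c) - h = c := by rw [one_nsmul]; abel
    rw [this]
    exact (mem_sdiff.1 hc).1
  have h1 := card_le_card hDA
  rw [card_image_of_injective _ sub_right_injective] at h1
  omega

/-- Sums of an even number `k = 2 j + 4 ≥ 6` of elements, from four elements and `j` pairs with a
common sum `h`. If `g` is missed, no `h` is the sum of more than `(k + 2) / 2` pairs. If this bound
is attained at `h`, then all four-element subsets with sum `g - j h` lie in `pairSupport A h`, so
for `c ∈ A` outside it `g - j h - c - x` is the sum of very few pairs for each `x ∈ A`. Otherwise
every `h` is the sum of exactly the average number `k / 2` of pairs, but for distinct `c, c' ∈ A`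
outside `pairSupport A h` only few pairs have sum `g - j h - c - c'`. -/
theorem isSubsetSum_even [IsAddCyclic G] {m j : ℕ} (hG : Fintype.card G = 2 * m) (hj : 1 ≤ j)
    (hjm : 2 * (4 + 2 * j) ≤ m + 1) {A : Finset G} (hA : A.card = m + 1) (g : G) :
    IsSubsetSum A (4 + 2 * j) g := by
  by_contra hg
  have hmax : ∀ h, (pairSupport A h).card ≤ 2 * j + 6 := by
    intro h
    obtain ⟨C, hC, hC4, hCs⟩ := isSubsetSum_four hG (by omega) hA (g - j • h)
    have h1 := card_pairSupport_le_of_not_isSubsetSum hg hC hC4 hCs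
    have h2 : (C ∩ pairSupport A h).card ≤ 4 := hC4 ▸ card_le_card inter_subset_left
    omega
  have htot := sum_card_pairSupport A
  rw [hA, Nat.add_sub_cancel] at htot
  -- Completing `c, c'` by a pair with sum `g - j h - c - c'` gives a four-element set as in the
  -- exchange principle.
  have hfour : ∀ h, ∀ c ∈ A, ∀ c' ∈ A, c ≠ c' → ∀ y ∈ pairSupport A (g - j • h - c - c'),
      y ≠ c → y ≠ c' → g - j • h - c - c' - y ≠ c → g - j • h - c - c' - y ≠ c' →
      (pairSupport A h).card + 2 ≤ 2 * j
        + 2 * (({c, c', y, g - j • h - c - c' - y} : Finset G) ∩ pairSupport A h).card := by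
    intro h c hc c' hc' hcc y hy h1 h2 h3 h4
    rw [mem_pairSupport] at hy
    refine card_pairSupport_le_of_not_isSubsetSum hg ?_ ?_ ?_
    · simp [insert_subset_iff, hy.1, hy.2.1, hc, hc']
    · rw [card_insert_of_notMem (by simp [hcc, h1.symm, h3.symm]),
        card_eq_three.2 ⟨c', y, _, h2.symm, h4.symm, hy.2.2.symm, rfl⟩]
    · rw [sum_insert (by simp [hcc, h1.symm, h3.symm]), sum_insert (by simp [h2.symm, h4.symm]),
        sum_pair hy.2.2.symm]
      abel
  by_cases hcase : ∃ h, 2 * j + 5 ≤ (pairSupport A h).card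
  · -- Four-element sets with sum `g - j h` lie in `pairSupport A h`, so they do not contain `c`.
    obtain ⟨h, hh⟩ := hcase
    obtain ⟨c, hc⟩ : (A \ pairSupport A h).Nonempty := by
      have := hmax h
      rw [← card_pos, card_sdiff_of_subset (pairSupport_subset A h)]
      omega
    rw [mem_sdiff] at hc
    have hlow : ∀ x ∈ A.erase c, (pairSupport A (g - j • h - c - x)).card
        ≤ 2 + if g - j • h - c - c - x ∈ A then 2 else 0 := by
      intro x hx
      rw [mem_erase] at hx
      have h0 : ∀ y ∈ pairSupport A (g - j • h - c - x), y = c ∨ y = x ∨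
          g - j • h - c - x - y = c ∨ g - j • h - c - x - y = x := by
        intro y hy
        by_contra! hcon
        have h1 := hfour h c hc.1 x hx.2 hx.1.symm y hy hcon.1 hcon.2.1 hcon.2.2.1 hcon.2.2.2
        rw [insert_inter_of_notMem hc.2] at h1
        have h2 : (({x, y, g - j • h - c - x - y} : Finset G) ∩ pairSupport A h).card ≤ 3 :=
          (card_le_card inter_subset_left).trans card_le_three
        omega
      have hpart : g - j • h - c - x - c = g - j • h - c - c - x := by abel
      split_ifs with hmem
      · have h1 : pairSupport A (g - j • h - c - x)
            ⊆ {c, x, g - j • h - c - x - c, g - j • h - c - x - x} := by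
          intro y hy
          simp only [mem_insert, mem_singleton]
          obtain e | e | e | e := h0 y hy
          · exact Or.inl e
          · exact Or.inr (Or.inl e)
          · exact Or.inr (Or.inr (Or.inl (eq_sub_of_sub_eq e)))
          · exact Or.inr (Or.inr (Or.inr (eq_sub_of_sub_eq e)))
        exact (card_le_card h1).trans card_le_four
      · have h1 : pairSupport A (g - j • h - c - x) ⊆ {x, g - j • h - c - x - x} := by
          intro y hy
          have hyA := mem_pairSupport.1 hy
          simp only [mem_insert, mem_singleton]
          obtain e | e | e | e := h0 y hy
          · rw [e, hpart] at hyA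
            exact absurd hyA.2.1 hmem
          · exact Or.inl e
          · have : y = g - j • h - c - c - x := by
              rw [← hpart, ← eq_sub_of_sub_eq e]
            exact absurd (this ▸ hyA.1) hmem
          · exact Or.inr (eq_sub_of_sub_eq e)
        exact (card_le_card h1).trans card_le_two
    have herase : (A.erase c).card = m := by rw [card_erase_of_mem hc.1, hA, Nat.add_sub_cancel]
    set T := (A.erase c).image fun x => g - j • h - c - x with hT
    have hTcard : T.card = m := by
      rw [hT, card_image_of_injective _ sub_right_injective, herase]
    have hTsum : ∑ l ∈ T, (pairSupport A l).card ≤ 2 * m + 2 * (2 * j + 8) := by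
      rw [hT, sum_image fun _ _ _ _ e => sub_right_injective e]
      refine (sum_le_sum hlow).trans ?_
      rw [sum_add_distrib, sum_const, herase, smul_eq_mul, mul_comm, ← sum_filter, sum_const,
        smul_eq_mul, mul_comm _ 2]
      have h1 := (card_le_card (filter_subset_filter (fun x => g - j • h - c - c - x ∈ A)
        (erase_subset c A))).trans (card_filter_sub_mem_le A (g - j • h - c - c))
      have h2 := hmax (g - j • h - c - c)
      omega
    have hTcompl : ∑ l ∈ Tᶜ, (pairSupport A l).card ≤ m * (2 * j + 6) := by
      have h1 := sum_le_card_nsmul Tᶜ (fun l => (pairSupport A l).card) _ fun l _ => hmax l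
      rw [card_compl, hG, hTcard, smul_eq_mul] at h1
      rwa [show 2 * m - m = m by omega] at h1
    rw [← sum_add_sum_compl T] at htot
    nlinarith
  · push Not at hcase
    have hall : ∀ h, (pairSupport A h).card = 2 * j + 4 := by
      by_contra! hcon
      obtain ⟨h, hh⟩ := hcon
      have h1 : ∑ l, (pairSupport A l).card < ∑ _l : G, (2 * j + 4) := by
        refine sum_lt_sum (fun l _ => Nat.le_of_lt_succ (hcase l)) ⟨h, mem_univ _, ?_⟩
        have := hcase h
        omega
      rw [htot, sum_const, card_univ, hG, smul_eq_mul] at h1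
      nlinarith
    obtain ⟨c, hc, c', hc', hcc⟩ := one_lt_card.1 (show 1 < (A \ pairSupport A g).card by
      rw [card_sdiff_of_subset (pairSupport_subset A g), hall, hA]
      omega)
    rw [mem_sdiff] at hc hc'
    have h1 : pairSupport A (g - j • g - c - c')
        ⊆ {c, c', g - j • g - c - c' - c, g - j • g - c - c' - c'} := by
      intro y hy
      by_contra hcon
      simp only [mem_insert, mem_singleton, not_or] at hcon
      have h2 := hfour g c hc.1 c' hc'.1 hcc y hy hcon.1 hcon.2.1
        (fun e => hcon.2.2.1 (eq_sub_of_sub_eq e))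
        (fun e => hcon.2.2.2 (eq_sub_of_sub_eq e))
      rw [insert_inter_of_notMem hc.2, insert_inter_of_notMem hc'.2, hall] at h2
      have h3 : (({y, g - j • g - c - c' - y} : Finset G) ∩ pairSupport A g).card ≤ 2 :=
        (card_le_card inter_subset_left).trans card_le_two
      omega
    have h2 := (card_le_card h1).trans card_le_four
    rw [hall] at h2
    omega

/-- A subset of more than half the elements of a cyclic group of order `2 m` represents every
element as a sum of `k` distinct elements, for `3 ≤ k ≤ m - 2`. By passing to complements it is
enough to treat `k ≤ (m + 1) / 2`. The case `m = 7`, where the count for `k = 4` is not sharp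
enough, is left out; it would correspond to a field of order `15`. -/
theorem isSubsetSum_of_card_eq_succ [IsAddCyclic G] {m k : ℕ} (hG : Fintype.card G = 2 * m)
    (hm : 6 ≤ m) (hm7 : m ≠ 7) (hk3 : 3 ≤ k) (hkm : k + 2 ≤ m) {A : Finset G}
    (hA : A.card = m + 1) (g : G) : IsSubsetSum A k g := by
  have half : ∀ k, 3 ≤ k → 2 * k ≤ m + 1 → ∀ g, IsSubsetSum A k g := by
    intro k hk3 hkm g
    obtain ⟨i, rfl | rfl⟩ := Nat.even_or_odd' k
    · obtain h2 | h2 : i = 2 ∨ 3 ≤ i := by omega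
      · subst h2
        exact isSubsetSum_four hG (by omega) hA g
      · obtain ⟨j, rfl⟩ : ∃ j, i = j + 2 := ⟨i - 2, by omega⟩
        rw [show 2 * (j + 2) = 4 + 2 * j by ring] at *
        exact isSubsetSum_even hG (by omega) (by omega) hA g
    · obtain h1 | h1 : i = 1 ∨ 2 ≤ i := by omega
      · subst h1
        exact isSubsetSum_three hG hm hA g
      · obtain ⟨j, rfl⟩ : ∃ j, i = j + 1 := ⟨i - 1, by omega⟩
        rw [show 2 * (j + 1) + 1 = 3 + 2 * j by ring] at *
        exact isSubsetSum_odd hG (by omega) (by omega) hA g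
  by_cases hk : 2 * k ≤ m + 1
  · exact half k hk3 hk g
  · obtain ⟨S, hS, hSc, hSs⟩ := half (m + 1 - k) (by omega) (by omega) (∑ x ∈ A, x - g)
    refine ⟨A \ S, sdiff_subset, ?_, ?_⟩
    · rw [card_sdiff_of_subset hS, hA, hSc]
      omega
    · rw [sum_sdiff_eq_sub hS, hSs, sub_sub_cancel]

end SubsetSums

/-! ### Zeros of twisted polynomials -/

section Codes

open Polynomial

variable {F : Type*} [Field F] {k n : ℕ} {η : F}

lemma mem_twistedPolynomials_one_zero (hk : 1 ≤ k) {f : F[X]} (hf : f.natDegree ≤ k)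
    (hc : f.coeff k = η * f.coeff 0) : f ∈ twistedPolynomials k 1 0 η := by
  refine ⟨f.coeff, ?_⟩
  rw [Nat.sub_add_cancel hk, ← hc, ← sum_range_succ]
  exact as_sum_range_C_mul_X_pow' f (Nat.lt_succ_of_le hf)

lemma natDegree_le_of_mem_twistedPolynomials (hk : 1 ≤ k) {f : F[X]}
    (hf : f ∈ twistedPolynomials k 1 0 η) : f.natDegree ≤ k := by
  obtain ⟨a, rfl⟩ := hf
  rw [Nat.sub_add_cancel hk]
  refine natDegree_add_le_of_degree_le (natDegree_sum_le_of_forall_le _ _ fun i hi => ?_)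
    (natDegree_C_mul_X_pow_le _ _)
  exact (natDegree_C_mul_X_pow_le _ _).trans (Finset.mem_range.1 hi).le

lemma maxDegree_twistedPolynomials (hk : 1 ≤ k) (hη : η ≠ 0) :
    maxDegree (twistedPolynomials k 1 0 η) = k := by
  refine IsGreatest.csSup_eq ⟨⟨C η * X ^ k + C 1, ?_, ?_⟩, ?_⟩
  · refine mem_twistedPolynomials_one_zero hk ?_ ?_
    · exact natDegree_add_le_of_degree_le (natDegree_C_mul_X_pow_le _ _) (by simp)
    · have hk0 : k ≠ 0 := by omega
      simp [coeff_one, hk0, hk0.symm]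
  · rw [natDegree_add_C, natDegree_C_mul_X_pow k η hη]
  · rintro d ⟨f, hf, rfl⟩
    exact natDegree_le_of_mem_twistedPolynomials hk hf

lemma evalAt_infty (hk : 1 ≤ k) (hη : η ≠ 0) (f : F[X]) :
    evalAt (twistedPolynomials k 1 0 η) none f = f.coeff k := by
  rw [evalAt, maxDegree_twistedPolynomials hk hη, lcoeff_apply]

lemma finrank_twistedCode_le (hk : 1 ≤ k) (α : Fin n → OnePoint F) (η : F) :
    Module.finrank F (twistedCode α k 1 0 η) ≤ k := by
  classical
  let p : ℕ → F[X] := fun i => X ^ i + if i = 0 then C η * X ^ (k - 1 + 1) else 0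
  let s : Finset F[X] := (range k).image p
  let V := twistedPolynomials k 1 0 η
  let φ : F[X] →ₗ[F] Fin n → F := LinearMap.pi fun i => evalAt V (α i)
  have hV : V ≤ Submodule.span F (s : Set F[X]) := by
    rintro _ ⟨a, rfl⟩
    have h1 : ∑ i ∈ range k, C (a i) * X ^ i + C (η * a 0) * X ^ (k - 1 + 1)
        = ∑ i ∈ range k, a i • p i := by
      simp only [p, smul_add, sum_add_distrib, smul_ite, smul_zero, sum_ite_eq', mem_range,
        if_pos (show 0 < k by omega)]
      congr 1
      · simp only [smul_eq_C_mul]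
      · rw [smul_eq_C_mul, C_mul]; ring
    rw [h1]
    exact Submodule.sum_mem _ fun i hi => Submodule.smul_mem _ _
      (Submodule.subset_span (mem_coe.2 (mem_image_of_mem p hi)))
  have hC : twistedCode α k 1 0 η ≤ (Submodule.span F (s : Set F[X])).map φ := by
    rintro _ ⟨f, rfl⟩
    exact ⟨f, hV f.2, rfl⟩
  calc _ ≤ Module.finrank F ((Submodule.span F (s : Set F[X])).map φ) := Submodule.finrank_mono hC
    _ ≤ Module.finrank F (Submodule.span F (s : Set F[X])) := Submodule.finrank_map_le _ _
    _ ≤ s.card := finrank_span_finset_le_card s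
    _ ≤ k := card_image_le.trans (card_range k).le

/-- A nonzero codeword of an MDS code of dimension at most `k` has fewer than `k` zeros. -/
lemma card_zeros_lt_of_isMDS [DecidableEq F] (hk : 1 ≤ k) {α : Fin n → OnePoint F}
    (hMDS : IsMDS (twistedCode α k 1 0 η)) {f : F[X]} (hf : f ∈ twistedPolynomials k 1 0 η)
    (hne : ∃ i, evalAt (twistedPolynomials k 1 0 η) (α i) f ≠ 0) :
    (univ.filter fun i => evalAt (twistedPolynomials k 1 0 η) (α i) f = 0).card < k := by
  set c : Fin n → F := fun i => evalAt (twistedPolynomials k 1 0 η) (α i) f with hc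
  have hcC : c ∈ twistedCode α k 1 0 η := ⟨⟨f, hf⟩, rfl⟩
  have hc0 : c ≠ 0 := fun h => hne.elim fun i hi => hi (congrFun h i)
  have h1 : minDist (twistedCode α k 1 0 η) ≤ hammingDist c 0 :=
    Nat.sInf_le ⟨c, hcC, 0, zero_mem _, hc0, rfl⟩
  have h2 := finrank_twistedCode_le hk α η
  have h3 := card_filter_add_card_filter_not (s := univ) fun i => c i = 0
  rw [card_univ, Fintype.card_fin] at h3
  have h4 : hammingDist c 0 = (univ.filter fun i => ¬ c i = 0).card := rfl
  unfold IsMDS at hMDS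
  change (univ.filter fun i => c i = 0).card < k
  omega

lemma coeff_zero_prod_X_sub_C (S : Finset F) :
    (∏ a ∈ S, (X - C a)).coeff 0 = (-1) ^ S.card * ∏ a ∈ S, a := by
  rw [coeff_zero_prod, ← prod_const, ← prod_mul_distrib]
  simp

lemma card_le_card_zeros [DecidableEq F] {α : Fin n → OnePoint F} (S : Finset F)
    (hS : ∀ a ∈ S, ∃ i, α i = some a) (V : Submodule F F[X]) :
    S.card ≤ (univ.filter fun i => evalAt V (α i) (∏ a ∈ S, (X - C a)) = 0).card := by
  refine card_le_card_of_surjOn (fun i => (α i).getD 0) ?_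
  intro a ha
  obtain ⟨i, hi⟩ := hS a ha
  refine ⟨i, mem_coe.2 (mem_filter.2 ⟨mem_univ _, ?_⟩), by simp [hi]⟩
  have : eval a (∏ a ∈ S, (X - C a)) = 0 := by
    rw [eval_prod]
    exact prod_eq_zero ha (by simp)
  rw [hi]
  exact this

/-- If `k` of the finite evaluation points have product `(-1) ^ k / η`, then the monic polynomial
with these roots is a twisted polynomial with too many zeros. -/
lemma prod_ne_of_isMDS [DecidableEq F] (hη : η ≠ 0) (hk : 1 ≤ k) (hkn : k < n)
    {α : Fin n → OnePoint F} (hα : Function.Injective α)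
    (hMDS : IsMDS (twistedCode α k 1 0 η)) {S : Finset F} (hSk : S.card = k)
    (hS : ∀ a ∈ S, ∃ i, α i = some a) : η * ((-1) ^ k * ∏ a ∈ S, a) ≠ 1 := by
  intro hprod
  set f : F[X] := ∏ a ∈ S, (X - C a) with hf
  have hdeg : f.natDegree = k := by rw [hf, natDegree_finsetProd_X_sub_C_eq_card, hSk]
  have hlead : f.coeff k = 1 := by
    have h := monic_prod_X_sub_C id S
    rw [← hdeg]
    exact h
  have hfV : f ∈ twistedPolynomials k 1 0 η := by
    refine mem_twistedPolynomials_one_zero hk hdeg.le ?_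
    rw [hlead, hf, coeff_zero_prod_X_sub_C, hSk, hprod]
  have hne : ∃ i, evalAt (twistedPolynomials k 1 0 η) (α i) f ≠ 0 := by
    by_contra! hcon
    have h1 : n ≤ (S.image (fun a => (some a : OnePoint F))).card := by
      rw [← Fintype.card_fin n, ← card_univ]
      refine card_le_card_of_injOn α (fun i _ => ?_) hα.injOn
      have h2 := hcon i
      rcases hi : α i with _ | a
      · rw [hi, evalAt_infty hk hη, hlead] at h2
        exact absurd h2 one_ne_zero
      · rw [hi] at h2
        have h2 : eval a f = 0 := h2
        rw [hf, eval_prod, prod_eq_zero_iff] at h2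
        obtain ⟨b, hb, hab⟩ := h2
        rw [eval_sub, eval_X, eval_C, sub_eq_zero] at hab
        exact mem_coe.2 (mem_image.2 ⟨b, hb, by rw [hab]⟩)
    have h3 := h1.trans card_image_le
    omega
  have h1 := card_zeros_lt_of_isMDS hk hMDS hfV hne
  have h2 := card_le_card_zeros S hS (twistedPolynomials k 1 0 η)
  rw [← hf] at h2
  omega

/-- The points `0` and `∞` are not both evaluation points: a monic polynomial of degree `k - 1`
with `k - 1` of the finite evaluation points as roots, one of them `0`, is a twisted polynomial
that vanishes at `∞` as well. -/
lemma card_ne_of_isMDS [DecidableEq F] (hη : η ≠ 0) (hk : 1 ≤ k) (hkn : k < n)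
    {α : Fin n → OnePoint F} (hα : Function.Injective α)
    (hMDS : IsMDS (twistedCode α k 1 0 η)) {S : Finset F} (h0 : 0 ∈ S)
    (hS : ∀ a ∈ S, ∃ i, α i = some a) (hinf : ∃ i, α i = none) : S.card + 1 ≠ k := by
  intro hSk
  set f : F[X] := ∏ a ∈ S, (X - C a) with hf
  have hdeg : f.natDegree = S.card := by rw [hf, natDegree_finsetProd_X_sub_C_eq_card]
  have hlead : f.coeff k = 0 := coeff_eq_zero_of_natDegree_lt (by omega)
  have hfV : f ∈ twistedPolynomials k 1 0 η := by
    refine mem_twistedPolynomials_one_zero hk (by omega) ?_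
    rw [hlead, hf, coeff_zero_prod_X_sub_C, prod_eq_zero h0 rfl, mul_zero, mul_zero]
  have hroot : ∀ a, eval a f = 0 ↔ a ∈ S := by
    intro a
    simp [hf, eval_prod, prod_eq_zero_iff, sub_eq_zero]
  have hne : ∃ i, evalAt (twistedPolynomials k 1 0 η) (α i) f ≠ 0 := by
    by_contra! hcon
    have h1 : n ≤ (insert none (S.image (fun a => (some a : OnePoint F)))).card := by
      rw [← Fintype.card_fin n, ← card_univ]
      refine card_le_card_of_injOn α (fun i _ => ?_) hα.injOn
      have h2 := hcon i
      rcases hi : α i with _ | a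
      · exact mem_coe.2 (mem_insert_self _ _)
      · rw [hi] at h2
        exact mem_coe.2 (mem_insert_of_mem (mem_image_of_mem _ ((hroot a).1 h2)))
    have h3 := h1.trans (card_insert_le _ _)
    have h4 : (S.image (fun a => (some a : OnePoint F))).card ≤ S.card := card_image_le
    omega
  have h1 := card_zeros_lt_of_isMDS hk hMDS hfV hne
  have h2 : k ≤ (univ.filter fun i =>
      evalAt (twistedPolynomials k 1 0 η) (α i) f = 0).card := by
    have h3 : (insert none (S.image some) : Finset (Option F)).card = k := by
      rw [card_insert_of_notMem (by simp), card_image_of_injective S (Option.some_injective F), hSk]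
    refine h3.symm.le.trans (card_le_card_of_surjOn α ?_)
    intro z hz
    obtain rfl | hz := mem_insert.1 (mem_coe.1 hz)
    · obtain ⟨i, hi⟩ := hinf
      refine ⟨i, mem_coe.2 (mem_filter.2 ⟨mem_univ _, ?_⟩), hi⟩
      rw [hi, evalAt_infty hk hη, hlead]
    · obtain ⟨a, ha, rfl⟩ := mem_image.1 hz
      obtain ⟨i, hi⟩ := hS a ha
      refine ⟨i, mem_coe.2 (mem_filter.2 ⟨mem_univ _, ?_⟩), hi⟩
      rw [hi]
      exact (hroot a).2 ha
  omega

/-- An MDS twisted code has at most one evaluation point outside `Fˣ`. -/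
lemma exists_units_of_isMDS [Fintype F] [DecidableEq F] (hη : η ≠ 0) (hk : 2 ≤ k)
    (hkn : k < n) {α : Fin n → OnePoint F} (hα : Function.Injective α)
    (hMDS : IsMDS (twistedCode α k 1 0 η)) :
    ∃ U : Finset Fˣ, (∀ u ∈ U, ∃ i, α i = some (u : F)) ∧ n ≤ U.card + 1 := by
  classical
  -- `OnePoint F` is `Option F` by definition.
  let β : Fin n → Option F := α
  set U := univ.filter fun u : Fˣ => ∃ i, β i = some (u : F) with hU
  set U' : Finset (Option F) := U.image fun u : Fˣ => some (u : F) with hU'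
  refine ⟨U, fun u hu => (mem_filter.1 hu).2, ?_⟩
  have hU'c : U'.card ≤ U.card := card_image_le
  have hcover : ∀ i, β i = none ∨ β i = some 0 ∨ β i ∈ U' := by
    intro i
    rcases hi : β i with _ | a
    · exact Or.inl rfl
    · by_cases ha : a = 0
      · exact Or.inr (Or.inl (by rw [ha]))
      · refine Or.inr (Or.inr (mem_image.2 ⟨Units.mk0 a ha, ?_, rfl⟩))
        rw [hU, mem_filter]
        exact ⟨mem_univ _, i, hi⟩
  have hcard : ∀ T : Finset (Option F), (∀ i, β i ∈ T) → n ≤ T.card := by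
    intro T hT
    rw [← Fintype.card_fin n, ← card_univ]
    exact card_le_card_of_injOn β (fun i _ => hT i) (Function.Injective.injOn hα)
  by_cases hinf : ∃ i, β i = none
  · by_cases hzero : ∃ i, β i = some 0
    · exfalso
      have h1 := hcard (insert none (insert (some 0) U')) fun i => by
        simpa only [mem_insert] using hcover i
      have h2 := h1.trans ((card_insert_le _ _).trans
        (Nat.add_le_add_right (card_insert_le _ _) 1))
      obtain ⟨T, hT, hTc⟩ := exists_subset_card_eq (s := U) (n := k - 2) (by omega)
      refine card_ne_of_isMDS hη (by omega) hkn hα hMDS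
        (S := insert 0 (T.image fun u : Fˣ => (u : F))) (mem_insert_self _ _) ?_ hinf ?_
      · intro a ha
        obtain rfl | ha := mem_insert.1 ha
        · exact hzero
        · obtain ⟨u, hu, rfl⟩ := mem_image.1 ha
          exact (mem_filter.1 (hT hu)).2
      · rw [card_insert_of_notMem (by simp), card_image_of_injective _ Units.val_injective, hTc]
        omega
    · have h1 := hcard (insert none U') fun i => by
        rw [mem_insert]
        exact (hcover i).imp_right fun h => h.resolve_left fun h => hzero ⟨i, h⟩
      exact h1.trans ((card_insert_le _ _).trans (Nat.add_le_add_right hU'c 1))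
  · have h1 := hcard (insert (some 0) U') fun i => by
      rw [mem_insert]
      exact (hcover i).resolve_left fun h => hinf ⟨i, h⟩
    exact h1.trans ((card_insert_le _ _).trans (Nat.add_le_add_right hU'c 1))

lemma card_ne_fifteen (F : Type*) [Field F] [Fintype F] : Fintype.card F ≠ 15 := by
  intro h
  obtain ⟨p, e, hp, -, hpe⟩ := FiniteField.isPrimePow_card F
  rw [h] at hpe
  have hp := hp.nat_prime
  have h3 := (Nat.prime_dvd_prime_iff_eq Nat.prime_three hp).1
    (Nat.prime_three.dvd_of_dvd_pow (show 3 ∣ p ^ e by rw [hpe]; norm_num))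
  have h5 := (Nat.prime_dvd_prime_iff_eq Nat.prime_five hp).1
    (Nat.prime_five.dvd_of_dvd_pow (show 5 ∣ p ^ e by rw [hpe]; norm_num))
  omega

end Codes
end TwistedRS

theorem mainTheorem5 {F : Type*} [Field F] [Fintype F] [DecidableEq F]
    (hodd : Odd (Fintype.card F)) (hq : 13 ≤ Fintype.card F)
    (η : F) (hη : η ≠ 0)
    (k : ℕ) (hk3 : 3 ≤ k) (hk : (k : ℚ) ≤ ((Fintype.card F : ℚ) - 1) / 2 - 2)
    (n : ℕ) (hkn : k < n)
    (α : Fin n → OnePoint F) (hα : Function.Injective α)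
    (hMDS : TwistedRS.IsMDS (TwistedRS.twistedCode α k 1 0 η)) :
    (n : ℚ) ≤ ((Fintype.card F : ℚ) + 1) / 2 := by
  classical
  obtain ⟨m, hm⟩ := hodd
  have h15 := TwistedRS.card_ne_fifteen F
  have hkm : k + 2 ≤ m := by
    rw [hm] at hk
    push_cast at hk
    have : (k : ℚ) + 2 ≤ m := by linarith
    exact_mod_cast this
  suffices hnm : n ≤ m + 1 by
    have : (n : ℚ) ≤ m + 1 := by exact_mod_cast hnm
    rw [hm]
    push_cast
    linarith
  by_contra! hcon
  obtain ⟨U, hUα, hUn⟩ := TwistedRS.exists_units_of_isMDS hη (by omega) hkn hα hMDS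
  obtain ⟨T, hT, hTc⟩ := Finset.exists_subset_card_eq (n := m + 1)
    (show m + 1 ≤ U.card by omega)
  have hG : Fintype.card (Additive Fˣ) = 2 * m := by
    rw [Fintype.card_additive, Fintype.card_units]
    omega
  -- A `k`-subset of `T` with product `((-1) ^ k * η)⁻¹`.
  obtain ⟨S, hS, hSk, hSs⟩ := TwistedRS.isSubsetSum_of_card_eq_succ (k := k) hG (by omega)
    (by omega) hk3 hkm (A := T.map Additive.ofMul.toEmbedding) (by rw [Finset.card_map, hTc])
    (Additive.ofMul ((-1) ^ k * Units.mk0 η hη)⁻¹)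
  have hinj : Function.Injective fun x : Additive Fˣ => ((x.toMul : Fˣ) : F) :=
    Units.val_injective.comp Additive.toMul.injective
  refine TwistedRS.prod_ne_of_isMDS hη (by omega) hkn hα hMDS
    (S := S.image fun x => ((x.toMul : Fˣ) : F)) ?_ ?_ ?_
  · rw [Finset.card_image_of_injective _ hinj, hSk]
  · intro a ha
    obtain ⟨x, hx, rfl⟩ := Finset.mem_image.1 ha
    obtain ⟨u, hu, rfl⟩ := Finset.mem_map.1 (hS hx)
    exact hUα u (hT hu)
  · rw [Finset.prod_image hinj.injOn, ← Units.coe_prod, ← toMul_sum, hSs, toMul_ofMul]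
    have h1 : ((-1 : Fˣ) ^ k * Units.mk0 η hη) * ((-1) ^ k * Units.mk0 η hη)⁻¹ = 1 :=
      mul_inv_cancel _
    have h2 := congrArg (fun u : Fˣ => (u : F)) h1
    simp only [Units.val_mul, Units.val_pow_eq_pow_val, Units.val_neg, Units.val_one,
      Units.val_mk0] at h2
    linear_combination h2
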